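/- **Setting.** Let $G=(A\cup B,E)$ be a finite bipartite graph in which every vertex strictly ranks its neighbors and every $a\in A$ has at least one neighbor. For matchings $M,N$ in $G$, a vertex votes for the one in which it has the better assignment (being unmatched is worst; no vote if the assignments coincide). $M$ is *popular* if for every matching $N$ at least as many vertices vote for $M$ as for $N$; $M$ is *$A$-popular* if the same holds when only the votes of vertices in $A$ are counted; $M$ is *fully popular* if both hold. Add to $G$ a self-loop $(u,u)$ for each vertex $u$, ranked last by $u$; a matching is understood to contain the self-loops of the vertices it leaves unmatched. For $a\in A$ let $f(a)$ be its top choice neighbor, and let $s(a)$ be its most preferred neighbor that is not $f(a')$ for any $a'\in A$ ($s(a)=a$ if there is none). The *valid* edges and self-loops are $(a,f(a)),(a,s(a))$ for $a\in A$, and $(b,b)$ for those $b\in B$ that are not $f(a)$ for any $a \in A$. An edge or self-loop is *popular* if some popular matching contains it, and *legal* if it is valid and popular. The *popular subgraph* $G_0$ on $A\cup B$ consists of the popular edges. **The graph $H$.** It has vertices $u_\ell$ (left) and $u_r$ (right) for $u\in A\cup B$. For each $(a,b)\in E$ it has the edges $(a_\ell^+,b_r^-),(a_\ell^-,b_r^+)$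 (upper half) and $(b_\ell^+,a_r^-),(b_\ell^-,a_r^+)$ (lower half), and for each $u$ the edge $(u_\ell^-,u_r^+)$. Every vertex of $H$ prefers neighbors with superscript $-$ to neighbors with superscript $+$, and ranks neighbors with the same superscript as in $G$, with its own twin after all its other neighbors having that superscript. A matching in $H$ is *stable* if no edge of $H$ is such that both of its endpoints prefer it to their assignments (being unmatched is worst). It is *legal* if each of its edges comes from a legal edge or self-loop of $G$; edges of $H$ that do not are forbidden. **The algorithm.** The Gale–Shapley algorithm with forbidden edges lets each unassigned left vertex propose along its best edge not yet deleted. The vertex receiving the proposal deletes all its worse edges (giving up the one it held, if any), and then holds the proposed edge, unless that edge is forbidden, in which case it is rejected and deleted too. It halts when no proposal is possible, and fails if some vertex of $H$ is then unmatched. 1. Run it in $H$. If it fails, stop without returning a matching; otherwise let $S_0$ be the resulting matching. All vertices are unmarked; $i=0$. 2. Let $A_-=\{a \in A:(a_\ell^-,b_r^+)\in S_i \text{ for some } b\in B\}$, $A'_+=\{a \in A:(b_\ell^-,a_r^+)\in S_i\text{ for some } b\in B\}$, $B_+=\{b \in B:(a_\ell^-,b_r^+)\in S_i\text{ for some } a\in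 A\}$ and $B'_-=\{b \in B:(b_\ell^-,a_r^+)\in S_i\text{ for some } a\in A\}$. While there is an unmarked vertex $v\in(A_-\cap A'_+)\cup(B_+\cap B'_-)$: choose any such $v$; mark all vertices in the connected component of $v$ in $G_0$; forbid in addition all edges $(a_\ell^+,*)$ and $(*,a_r^-)$ for the agents $a\in A$ in that component; reject (delete) those held edges that are now forbidden, and continue the Gale–Shapley algorithm. If it fails, stop without returning a matching; otherwise increase $i$ by one and let $S_i$ be the resulting matching, for which the four sets are formed anew. 3. Return $M=\{(a,b)\in E:(a_\ell^+,b_r^-)\text{ or }(a_\ell^-,b_r^+)\text{ is in }S_i\}$ for the final $S_i$. **Theorem.** Whenever the algorithm returns a matching $M$ (for any choices of proposing vertices and of $v$), the final $S_i$ is a legal stable matching in $H$, and $M$ is popular in $G$. Moreover $M$ is $A$-popular, and hence fully popular. -/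

import Mathlib

/-- A marriage instance on the vertex set `V`: a bipartite graph whose two sides are the agents and
the jobs (the non-agents), in which every vertex ranks its neighbors strictly.
`prefers u v w` means that `u` strictly prefers `v` to `w`; it only matters for neighbors `v`, `w`
of `u`. -/
structure MarriageInstance (V : Type*) where
  graph : SimpleGraph V
  agents : Set V
  bipartite : graph.IsBipartiteWith agents agentsᶜ
  prefers : V → V → V → Prop
  strict : ∀ u, IsStrictTotalOrder (graph.neighborSet u) (fun v w => prefers u v w)

/-- The superscripts on the endpoints of the edges of the doubled graph. -/
inductive Superscript where
  | plus : Superscript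
  | minus : Superscript

/-- A potential edge between the left copy of `left` and the right copy of `right`. The superscript
of the left endpoint is `leftSign`; the superscript of the right endpoint is the opposite one. -/
@[ext] structure HEdge (V : Type*) where
  left : V
  right : V
  leftSign : Superscript

/-- A state of the Gale-Shapley algorithm: the edges deleted so far, and the edges of the current
tentative assignment. -/
structure GSState (V : Type*) where
  deleted : Set (HEdge V)
  held : Set (HEdge V)

/-- A state of the main algorithm: the Gale-Shapley state (whose `held` is the current matching
`S_i`), and the set of marked vertices. -/
structure AlgState (V : Type*) where
  gs : GSState V
  marked : Set V

namespace MarriageInstance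

variable {V : Type*} (G : MarriageInstance V)

/-! ### Popular matchings -/

/-- `u` votes for `M` against `N`: it is matched in `M`, and it is unmatched in `N` or prefers its
partner in `M` to its partner in `N`. -/
def VotesFor (M N : G.graph.Subgraph) (u : V) : Prop :=
  ∃ v, M.Adj u v ∧ ∀ w, N.Adj u w → G.prefers u v w

/-- The number of votes for `M` against `N`. -/
noncomputable def phi (M N : G.graph.Subgraph) : ℕ :=
  {u | G.VotesFor M N u}.ncard

/-- The number of votes of agents for `M` against `N`. -/
noncomputable def phiA (M N : G.graph.Subgraph) : ℕ :=
  {u | u ∈ G.agents ∧ G.VotesFor M N u}.ncard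

def Popular (M : G.graph.Subgraph) : Prop :=
  M.IsMatching ∧ ∀ N : G.graph.Subgraph, N.IsMatching → G.phi N M ≤ G.phi M N

def APopular (M : G.graph.Subgraph) : Prop :=
  M.IsMatching ∧ ∀ N : G.graph.Subgraph, N.IsMatching → G.phiA N M ≤ G.phiA M N

def FullyPopular (M : G.graph.Subgraph) : Prop :=
  G.Popular M ∧ G.APopular M

/-! ### Valid, popular and legal edges and self-loops -/

/-- `b` is `f(a)`, the top choice neighbor of `a`. -/
def IsF (a b : V) : Prop :=
  G.graph.Adj a b ∧ ∀ c, G.graph.Adj a c → c ≠ b → G.prefers a b c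

/-- `b` is the top choice neighbor of some agent. -/
def IsTopChoice (b : V) : Prop :=
  ∃ a ∈ G.agents, G.IsF a b

/-- `v` is `s(a)`: the most preferred neighbor of `a` that is nobody's top choice neighbor, and `a`
itself if there is no such neighbor. -/
def IsS (a v : V) : Prop :=
  (G.graph.Adj a v ∧ ¬ G.IsTopChoice v ∧
    ∀ c, G.graph.Adj a c → ¬ G.IsTopChoice c → c ≠ v → G.prefers a v c) ∨
  (v = a ∧ ∀ c, G.graph.Adj a c → G.IsTopChoice c)

/-- The edge (or, if `u = v`, the self-loop) with endpoints `u` and `v` is valid. -/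
def Valid (u v : V) : Prop :=
  (u ∈ G.agents ∧ (G.IsF u v ∨ G.IsS u v)) ∨
  (v ∈ G.agents ∧ (G.IsF v u ∨ G.IsS v u)) ∨
  (u = v ∧ u ∉ G.agents ∧ ¬ G.IsTopChoice u)

/-- The edge (or, if `u = v`, the self-loop) with endpoints `u` and `v` is in some popular matching;
a matching contains the self-loops of the vertices that it leaves unmatched. -/
def PopularEdge (u v : V) : Prop :=
  ∃ M : G.graph.Subgraph, G.Popular M ∧ (M.Adj u v ∨ (u = v ∧ u ∉ M.verts))

def Legal (u v : V) : Prop :=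
  G.Valid u v ∧ G.PopularEdge u v

/-- The popular subgraph; its self-loops are omitted, as they play no role for connectivity. -/
def popularGraph : SimpleGraph V where
  Adj u v := G.graph.Adj u v ∧ G.PopularEdge u v
  symm := ⟨by
    rintro u v ⟨h, M, hM, h' | ⟨rfl, -⟩⟩
    · exact ⟨h.symm, M, hM, Or.inl h'.symm⟩
    · exact absurd h G.graph.irrefl⟩
  loopless := ⟨fun _ h => G.graph.irrefl h.1⟩

/-- The vertices of the connected component of `v` in the popular subgraph. -/
def component (v : V) : Set V :=
  {u | G.popularGraph.Reachable v u}

/-! ### The doubled graph `H` -/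

/-- The edges of `H`: two parallel edges for each of the two copies of an edge of `G`, and a single
edge `(u_ℓ^-, u_r^+)` for every vertex `u`. -/
def IsHEdge (e : HEdge V) : Prop :=
  G.graph.Adj e.left e.right ∨ (e.left = e.right ∧ e.leftSign = Superscript.minus)

/-- The preferences of `u` in `G` with `u` itself added at the end of its list. -/
def PrefersOrSelf (u v w : V) : Prop :=
  G.graph.Adj u v ∧ (w = u ∨ (G.graph.Adj u w ∧ G.prefers u v w))

/-- The common left endpoint of `e` and `e'` prefers `e` to `e'`. It prefers right neighbors with
superscript minus, that is, edges with `leftSign = plus`. -/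
def LeftPrefers (e e' : HEdge V) : Prop :=
  e.left = e'.left ∧
  ((e.leftSign = Superscript.plus ∧ e'.leftSign = Superscript.minus) ∨
    (e.leftSign = e'.leftSign ∧ G.PrefersOrSelf e.left e.right e'.right))

/-- The common right endpoint of `e` and `e'` prefers `e` to `e'`. It prefers left neighbors with
superscript minus. -/
def RightPrefers (e e' : HEdge V) : Prop :=
  e.right = e'.right ∧
  ((e.leftSign = Superscript.minus ∧ e'.leftSign = Superscript.plus) ∨
    (e.leftSign = e'.leftSign ∧ G.PrefersOrSelf e.right e.left e'.left))

/-- `S` is a matching in `H`. -/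
def IsHMatching (S : Set (HEdge V)) : Prop :=
  (∀ e ∈ S, G.IsHEdge e) ∧
  ∀ e ∈ S, ∀ e' ∈ S, (e.left = e'.left ∨ e.right = e'.right) → e = e'

/-- Both endpoints of the edge `e` of `H` prefer `e` to their assignments in `S`; being unmatched is
the worst assignment. -/
def Blocks (S : Set (HEdge V)) (e : HEdge V) : Prop :=
  G.IsHEdge e ∧
  (∀ e' ∈ S, e'.left = e.left → G.LeftPrefers e e') ∧
  (∀ e' ∈ S, e'.right = e.right → G.RightPrefers e e')

def IsStableH (S : Set (HEdge V)) : Prop :=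
  G.IsHMatching S ∧ ∀ e, ¬ G.Blocks S e

/-- No edge of `S` comes from an edge or self-loop that is not legal. -/
def IsLegalH (S : Set (HEdge V)) : Prop :=
  ∀ e ∈ S, G.Legal e.left e.right

/-! ### The Gale-Shapley algorithm with forbidden edges

The vertices on the left of `H` propose. -/

/-- In the state `s` the left endpoint of `e` is unassigned, and `e` is its most preferred edge
among those that have not been deleted. -/
def IsProposal (s : GSState V) (e : HEdge V) : Prop :=
  G.IsHEdge e ∧ e ∉ s.deleted ∧
  (∀ e' ∈ s.held, e'.left ≠ e.left) ∧
  ∀ e', G.IsHEdge e' → e'.left = e.left → e' ∉ s.deleted → e' ≠ e → G.LeftPrefers e e'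

/-- The right endpoint of `e` receives the proposal `e`. All edges that it ranks worse than `e` are
deleted (and so the edge that it held is given up). It holds `e` if `e` is not forbidden; otherwise
it rejects `e`, which is deleted as well. -/
def respond (F : Set (HEdge V)) (s : GSState V) (e : HEdge V) : GSState V where
  deleted := s.deleted ∪ {e' | G.IsHEdge e' ∧ G.RightPrefers e e'} ∪ {e' | e' = e ∧ e ∈ F}
  held := {e' | e' ∈ s.held ∧ ¬ G.RightPrefers e e'} ∪ {e' | e' = e ∧ e ∉ F}

/-- One proposal, with its response, when the edges in `F` are forbidden. -/
def GSStep (F : Set (HEdge V)) (s s' : GSState V) : Prop :=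
  ∃ e, G.IsProposal s e ∧ s' = G.respond F s e

/-- The algorithm, started in `s`, can halt in `s'`: no further proposal is possible in `s'`. -/
def GSRun (F : Set (HEdge V)) (s s' : GSState V) : Prop :=
  Relation.ReflTransGen (G.GSStep F) s s' ∧ ∀ e, ¬ G.IsProposal s' e

/-- No vertex of `H` is left unmatched by `S`. -/
def AllMatched (S : Set (HEdge V)) : Prop :=
  (∀ u, ∃ e ∈ S, e.left = u) ∧ ∀ u, ∃ e ∈ S, e.right = u

/-- The edges in `F` become forbidden: those that are currently held are rejected. -/
def forbid (F : Set (HEdge V)) (s : GSState V) : GSState V where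
  deleted := s.deleted ∪ (s.held ∩ F)
  held := s.held \ F

/-! ### The main algorithm -/

/-- The forbidden edges when the vertices in `C` are marked: the edges of `H` that come from edges
and self-loops that are not legal, and the edges `(a_ℓ^+, *)` and `(*, a_r^-)` for the agents `a`
in `C`. -/
def forbidden (C : Set V) : Set (HEdge V) :=
  {e | G.IsHEdge e ∧
    (¬ G.Legal e.left e.right ∨
      (e.leftSign = Superscript.plus ∧
        (e.left ∈ G.agents ∩ C ∨ e.right ∈ G.agents ∩ C)))}

/-- `A_-`: the agents `a` with `(a_ℓ^-, b_r^+) ∈ S` for some job `b`. -/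
def upperAgentsMinus (S : Set (HEdge V)) : Set V :=
  {a | a ∈ G.agents ∧ ∃ b, b ∉ G.agents ∧ ⟨a, b, Superscript.minus⟩ ∈ S}

/-- `B_+`: the jobs `b` with `(a_ℓ^-, b_r^+) ∈ S` for some agent `a`. -/
def upperJobsPlus (S : Set (HEdge V)) : Set V :=
  {b | b ∉ G.agents ∧ ∃ a, a ∈ G.agents ∧ ⟨a, b, Superscript.minus⟩ ∈ S}

/-- `A'_+`: the agents `a` with `(b_ℓ^-, a_r^+) ∈ S` for some job `b`. -/
def lowerAgentsPlus (S : Set (HEdge V)) : Set V :=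
  {a | a ∈ G.agents ∧ ∃ b, b ∉ G.agents ∧ ⟨b, a, Superscript.minus⟩ ∈ S}

/-- `B'_-`: the jobs `b` with `(b_ℓ^-, a_r^+) ∈ S` for some agent `a`. -/
def lowerJobsMinus (S : Set (HEdge V)) : Set V :=
  {b | b ∉ G.agents ∧ ∃ a, a ∈ G.agents ∧ ⟨b, a, Superscript.minus⟩ ∈ S}

/-- `(A_- ∩ A'_+) ∪ (B_+ ∩ B'_-)`. -/
def candidates (S : Set (HEdge V)) : Set V :=
  (G.upperAgentsMinus S ∩ G.lowerAgentsPlus S) ∪ (G.upperJobsPlus S ∩ G.lowerJobsMinus S)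

/-- The states that the algorithm can reach at the test of the while loop. If the Gale-Shapley
algorithm leaves a vertex unmatched, the main algorithm stops without a matching. -/
inductive Reaches : AlgState V → Prop
  | start (s : GSState V) (hrun : G.GSRun (G.forbidden ∅) ⟨∅, ∅⟩ s) (hs : AllMatched s.held) :
      Reaches ⟨s, ∅⟩
  | next (t : AlgState V) (ht : Reaches t) (v : V) (hv : v ∉ t.marked)
      (hc : v ∈ G.candidates t.gs.held) (s : GSState V)
      (hrun : G.GSRun (G.forbidden (t.marked ∪ G.component v))
        (forbid (G.forbidden (t.marked ∪ G.component v)) t.gs) s)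
      (hs : AllMatched s.held) :
      Reaches ⟨s, t.marked ∪ G.component v⟩

/-- The while loop can end with `S` as the final matching `S_i` in `H`. -/
def FinalMatching (S : Set (HEdge V)) : Prop :=
  ∃ t : AlgState V, G.Reaches t ∧ t.gs.held = S ∧ ∀ v ∈ G.candidates S, v ∈ t.marked

/-- `a` is an agent, `b` is a job, and `(a_ℓ^+, b_r^-)` or `(a_ℓ^-, b_r^+)` is in `S`. -/
def InUpperHalf (S : Set (HEdge V)) (a b : V) : Prop :=
  a ∈ G.agents ∧ b ∉ G.agents ∧
    (⟨a, b, Superscript.plus⟩ ∈ S ∨ ⟨a, b, Superscript.minus⟩ ∈ S)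

/-- The set `{(a, b) ∈ E : (a_ℓ^+, b_r^-) or (a_ℓ^-, b_r^+) is in S}` as a subgraph of `G`. -/
def upperHalf (S : Set (HEdge V)) : G.graph.Subgraph where
  verts := {u | ∃ v, G.graph.Adj u v ∧ (G.InUpperHalf S u v ∨ G.InUpperHalf S v u)}
  Adj u v := G.graph.Adj u v ∧ (G.InUpperHalf S u v ∨ G.InUpperHalf S v u)
  adj_sub h := h.1
  edge_vert h := ⟨_, h⟩
  symm := ⟨fun _ _ h => ⟨h.1.symm, h.2.symm⟩⟩

end MarriageInstance

namespace MarriageInstance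

variable {V : Type*} (G : MarriageInstance V)

/-! ### Preferences -/

/-! Stability does not depend on which edges are forbidden. Every edge that a left vertex prefers to
its held edge is deleted, and deletions are closed downwards at each right vertex, so an edge
blocking a perfect held matching would force the deletion of a held edge (`GSInvariant.isStableH`).
Legality holds because no held edge is forbidden.

For popularity, the final matching is encoded by partner maps (`LegalPairing`): `p a` is the upper
partner and `q a` the lower partner of an agent, and conversely for jobs. Weak LP duality
(`IsPartnerMap.phi_le_of_witness`) asks for vertex weights that cancel along M and dominate the
votes on all edges and self-loops. The weight is 0 at unmatched or marked vertices, and otherwise 1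
or -1 as the superscript in the upper half is plus or minus. Upper stability handles most edges. The
lower half is needed for unmatched jobs and for edges from an unmarked agent to a marked job. There
the two halves agree at the marked job (`marked_eq`), lower stability compares the job with `q a`,
and `not_between` transfers this to `p a`, using that no unmarked vertex is a candidate.

A-popularity needs only validity: an agent who prefers N gets somebody's top choice there, and the
M-partner of that job has its own top choice in M and loses it in N. -/

theorem agent_iff_of_adj {x y : V} (h : G.graph.Adj x y) : x ∈ G.agents ↔ y ∉ G.agents := by
  have h1 := G.bipartite.mem_of_adj h
  have h2 : ∀ z, z ∈ G.agentsᶜ ↔ z ∉ G.agents := fun z => Iff.rfl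
  simp only [h2] at h1
  tauto

theorem prefersOrSelf_irrefl (u v : V) : ¬ G.PrefersOrSelf u v v := by
  rintro ⟨h, rfl | ⟨h', hp⟩⟩
  · exact G.graph.irrefl h
  · have := G.strict u
    exact irrefl_of (fun v w : G.graph.neighborSet u => G.prefers u v w) ⟨v, h⟩ hp

theorem PrefersOrSelf.trans {u v w x : V} (h : G.PrefersOrSelf u v w)
    (h' : G.PrefersOrSelf u w x) : G.PrefersOrSelf u v x := by
  obtain ⟨hv, rfl | ⟨hw, hp⟩⟩ := h
  · exact absurd h'.1 G.graph.irrefl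
  obtain ⟨-, rfl | ⟨hx, hp'⟩⟩ := h'
  · exact ⟨hv, Or.inl rfl⟩
  have := G.strict u
  exact ⟨hv, Or.inr ⟨hx, trans_of (fun v w : G.graph.neighborSet u => G.prefers u v w)
    (a := ⟨v, hv⟩) (b := ⟨w, hw⟩) (c := ⟨x, hx⟩) hp hp'⟩⟩

theorem PrefersOrSelf.asymm {u v w : V} (h : G.PrefersOrSelf u v w) : ¬ G.PrefersOrSelf u w v :=
  fun h' => G.prefersOrSelf_irrefl u v (PrefersOrSelf.trans G h h')

theorem prefersOrSelf_total {u v w : V} (hv : G.graph.Adj u v ∨ v = u)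
    (hw : G.graph.Adj u w ∨ w = u) (hvw : v ≠ w) :
    G.PrefersOrSelf u v w ∨ G.PrefersOrSelf u w v := by
  rcases hv with hv | rfl
  · rcases hw with hw | rfl
    · have := G.strict u
      rcases trichotomous_of (fun v w : G.graph.neighborSet u => G.prefers u v w)
        ⟨v, hv⟩ ⟨w, hw⟩ with h | h | h
      · exact Or.inl ⟨hv, Or.inr ⟨hw, h⟩⟩
      · exact absurd (congrArg Subtype.val h) hvw
      · exact Or.inr ⟨hw, Or.inr ⟨hv, h⟩⟩
    · exact Or.inl ⟨hv, Or.inl rfl⟩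
  · rcases hw with hw | rfl
    · exact Or.inr ⟨hw, Or.inl rfl⟩
    · exact absurd rfl hvw

theorem IsF.prefersOrSelf {a b c : V} (h : G.IsF a b) (hc : G.graph.Adj a c ∨ c = a)
    (hcb : c ≠ b) : G.PrefersOrSelf a b c :=
  ⟨h.1, hc.elim (fun hc => Or.inr ⟨hc, h.2 c hc hcb⟩) Or.inl⟩

/-- `s(a)` is at least as good for `a` as any neighbor that is nobody's top choice. -/
theorem IsS.not_prefersOrSelf {a v c : V} (h : G.IsS a v) (hc : ¬ G.IsTopChoice c) :
    ¬ G.PrefersOrSelf a c v := by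
  intro hp
  rcases h with ⟨hv, -, h⟩ | ⟨rfl, h⟩
  · by_cases hcv : c = v
    · exact G.prefersOrSelf_irrefl a v (hcv ▸ hp)
    · exact PrefersOrSelf.asymm G hp ⟨hv, Or.inr ⟨hp.1, h c hp.1 hc hcv⟩⟩
  · exact hc (h c hp.1)

theorem LeftPrefers.irrefl (e : HEdge V) : ¬ G.LeftPrefers e e := by
  rintro ⟨-, ⟨h, h'⟩ | ⟨-, h⟩⟩
  · rw [h] at h'; exact Superscript.noConfusion h'
  · exact G.prefersOrSelf_irrefl _ _ h

theorem RightPrefers.irrefl (e : HEdge V) : ¬ G.RightPrefers e e := by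
  rintro ⟨-, ⟨h, h'⟩ | ⟨-, h⟩⟩
  · rw [h] at h'; exact Superscript.noConfusion h'
  · exact G.prefersOrSelf_irrefl _ _ h

theorem LeftPrefers.asymm {e e' : HEdge V} (h : G.LeftPrefers e e') : ¬ G.LeftPrefers e' e := by
  rintro ⟨he, h'⟩
  obtain ⟨-, h⟩ := h
  rw [he] at h'
  rcases h with ⟨h1, h2⟩ | ⟨h1, h2⟩ <;> rcases h' with ⟨h3, h4⟩ | ⟨h3, h4⟩
  all_goals first
    | exact PrefersOrSelf.asymm G h2 h4
    | simp_all

theorem RightPrefers.trans {e e' e'' : HEdge V} (h : G.RightPrefers e e')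
    (h' : G.RightPrefers e' e'') : G.RightPrefers e e'' := by
  obtain ⟨he, h⟩ := h
  obtain ⟨he', h'⟩ := h'
  refine ⟨he.trans he', ?_⟩
  rw [← he] at h'
  rcases h with ⟨h1, h2⟩ | ⟨h1, h2⟩ <;> rcases h' with ⟨h3, h4⟩ | ⟨h3, h4⟩
  · simp_all
  · exact Or.inl ⟨h1, h3 ▸ h2⟩
  · exact Or.inl ⟨h1.trans h3, h4⟩
  · exact Or.inr ⟨h1.trans h3, PrefersOrSelf.trans G h2 h4⟩

theorem rightPrefers_total {e e' : HEdge V} (he : G.IsHEdge e) (he' : G.IsHEdge e')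
    (hr : e.right = e'.right) (hne : e ≠ e') : G.RightPrefers e e' ∨ G.RightPrefers e' e := by
  obtain ⟨x, y, σ⟩ := e
  obtain ⟨x', y', σ'⟩ := e'
  obtain rfl : y = y' := hr
  by_cases hσ : σ = σ'
  · subst hσ
    have hx : x ≠ x' := fun h => hne (by rw [h])
    rcases G.prefersOrSelf_total (u := y) (he.imp (fun h => h.symm) (fun h => h.1))
      (he'.imp (fun h => h.symm) (fun h => h.1)) hx with h | h
    · exact Or.inl ⟨rfl, Or.inr ⟨rfl, h⟩⟩
    · exact Or.inr ⟨rfl, Or.inr ⟨rfl, h⟩⟩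
  · cases σ <;> cases σ'
    · exact absurd rfl hσ
    · exact Or.inr ⟨rfl, Or.inl ⟨rfl, rfl⟩⟩
    · exact Or.inl ⟨rfl, Or.inl ⟨rfl, rfl⟩⟩
    · exact absurd rfl hσ

/-! ### Invariants of the Gale-Shapley algorithm -/

/-- The invariants of the Gale-Shapley algorithm that hold whatever edges are forbidden. -/
structure GSInvariant (s : GSState V) : Prop where
  matching : G.IsHMatching s.held
  disjoint : ∀ e ∈ s.held, e ∉ s.deleted
  left_best : ∀ e ∈ s.held, ∀ e', G.IsHEdge e' → G.LeftPrefers e' e → e' ∈ s.deleted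
  right_worse : ∀ e ∈ s.held, ∀ e', G.IsHEdge e' → G.RightPrefers e e' → e' ∈ s.deleted
  deleted_lower : ∀ e ∈ s.deleted, ∀ e', G.IsHEdge e' → G.RightPrefers e e' → e' ∈ s.deleted

theorem GSInvariant.empty : G.GSInvariant ⟨∅, ∅⟩ := by
  constructor <;> simp [IsHMatching]

variable {G}

theorem GSInvariant.respond {s : GSState V} (h : G.GSInvariant s) (F : Set (HEdge V))
    {e : HEdge V} (he : G.IsProposal s e) : G.GSInvariant (G.respond F s e) := by
  obtain ⟨heH, hed, hfree, hbest⟩ := he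
  -- A held edge that the receiving vertex ranks above `e` would already have caused the deletion of
  -- `e`, so every other held edge there is given up.
  have hright : ∀ e' ∈ s.held, ¬ G.RightPrefers e e' → e'.right ≠ e.right := by
    intro e' he' hn hr
    have hne : e' ≠ e := fun h => hfree e' he' (h ▸ rfl)
    rcases G.rightPrefers_total (h.matching.1 e' he') heH hr hne with h1 | h1
    · exact hed (h.right_worse e' he' e heH h1)
    · exact hn h1
  refine ⟨⟨?_, ?_⟩, ?_, ?_, ?_, ?_⟩
  · rintro e' (⟨he', -⟩ | ⟨rfl, -⟩)
    · exact h.matching.1 e' he'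
    · exact heH
  · rintro e₁ (⟨he₁, hn₁⟩ | ⟨rfl, -⟩) e₂ (⟨he₂, hn₂⟩ | ⟨rfl, -⟩) hc
    · exact h.matching.2 e₁ he₁ e₂ he₂ hc
    · exact hc.elim (fun hl => absurd hl (hfree e₁ he₁))
        (fun hr => absurd hr (hright e₁ he₁ hn₁))
    · exact hc.elim (fun hl => absurd hl.symm (hfree e₂ he₂))
        (fun hr => absurd hr.symm (hright e₂ he₂ hn₂))
    · rfl
  · rintro e' (⟨he', hn⟩ | ⟨rfl, hF⟩) ((hd | ⟨-, hd⟩) | ⟨hd, hF'⟩)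
    · exact h.disjoint e' he' hd
    · exact hn hd
    · exact hfree e' he' (hd ▸ rfl)
    · exact hed hd
    · exact RightPrefers.irrefl G _ hd
    · exact hF hF'
  · rintro e₁ (⟨he₁, -⟩ | ⟨rfl, -⟩) e' he' hp
    · exact Or.inl (Or.inl (h.left_best e₁ he₁ e' he' hp))
    · by_contra hd
      have hd' : e' ∉ s.deleted := fun h' => hd (Or.inl (Or.inl h'))
      have hne : e' ≠ e₁ := by rintro rfl; exact LeftPrefers.irrefl G _ hp
      exact LeftPrefers.asymm G hp (hbest e' he' hp.1 hd' hne)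
  · rintro e₁ (⟨he₁, -⟩ | ⟨rfl, -⟩) e' he' hp
    · exact Or.inl (Or.inl (h.right_worse e₁ he₁ e' he' hp))
    · exact Or.inl (Or.inr ⟨he', hp⟩)
  · rintro e₁ ((hd | ⟨-, hd⟩) | ⟨rfl, -⟩) e' he' hp
    · exact Or.inl (Or.inl (h.deleted_lower e₁ hd e' he' hp))
    · exact Or.inl (Or.inr ⟨he', RightPrefers.trans G hd hp⟩)
    · exact Or.inl (Or.inr ⟨he', hp⟩)

/-- A newly rejected edge was held, so `right_worse` already deleted everything below it at its
right end. Hence `deleted_lower` survives and the run may be resumed. -/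
theorem GSInvariant.forbid {s : GSState V} (h : G.GSInvariant s) (F : Set (HEdge V)) :
    G.GSInvariant (forbid F s) := by
  refine ⟨⟨fun e he => h.matching.1 e he.1, fun e he e' he' => h.matching.2 e he.1 e' he'.1⟩,
    ?_, fun e he e' he' hp => Or.inl (h.left_best e he.1 e' he' hp),
    fun e he e' he' hp => Or.inl (h.right_worse e he.1 e' he' hp), ?_⟩
  · rintro e he (hd | hd)
    · exact h.disjoint e he.1 hd
    · exact he.2 hd.2
  · rintro e (hd | hd) e' he' hp
    · exact Or.inl (h.deleted_lower e hd e' he' hp)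
    · exact Or.inl (h.right_worse e hd.1 e' he' hp)

theorem GSRun.invariant {F : Set (HEdge V)} {s s' : GSState V} (hrun : G.GSRun F s s')
    (h : G.GSInvariant s) (hF : ∀ e ∈ s.held, e ∉ F) :
    G.GSInvariant s' ∧ ∀ e ∈ s'.held, e ∉ F := by
  obtain ⟨hrun, -⟩ := hrun
  induction hrun with
  | refl => exact ⟨h, hF⟩
  | tail _ hstep ih =>
    obtain ⟨e, he, rfl⟩ := hstep
    refine ⟨ih.1.respond F he, ?_⟩
    rintro e' (⟨he', -⟩ | ⟨rfl, hF'⟩)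
    · exact ih.2 e' he'
    · exact hF'

theorem GSInvariant.isStableH {s : GSState V} (h : G.GSInvariant s) (hs : AllMatched s.held) :
    G.IsStableH s.held := by
  refine ⟨h.matching, ?_⟩
  rintro e ⟨heH, hl, hr⟩
  obtain ⟨e₁, he₁, h₁⟩ := hs.1 e.left
  obtain ⟨e₂, he₂, h₂⟩ := hs.2 e.right
  exact h.disjoint e₂ he₂ (h.deleted_lower e (h.left_best e₁ he₁ e heH (hl e₁ he₁ h₁)) e₂
    (h.matching.1 e₂ he₂) (hr e₂ he₂ h₂))

/-- Resuming starts from held edges purged of the new forbidden set, and the marked set grows by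
whole components, so it stays closed under popular edges. -/
theorem Reaches.invariant {t : AlgState V} (ht : G.Reaches t) :
    G.GSInvariant t.gs ∧ (∀ e ∈ t.gs.held, e ∉ G.forbidden t.marked) ∧ AllMatched t.gs.held ∧
      ∀ u v, G.popularGraph.Adj u v → u ∈ t.marked → v ∈ t.marked := by
  induction ht with
  | start s hrun hs =>
    have h := hrun.invariant (GSInvariant.empty G) (by simp)
    exact ⟨h.1, h.2, hs, by simp⟩
  | next t ht v hv hc s hrun hs ih =>
    have h := hrun.invariant (ih.1.forbid _) (fun e he => he.2)
    refine ⟨h.1, h.2, hs, ?_⟩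
    rintro x y hxy (hx | hx)
    · exact Or.inl (ih.2.2.2 x y hxy hx)
    · exact Or.inr (SimpleGraph.Reachable.trans hx hxy.reachable)

/-! ### Valid edges -/

theorem Valid.symm {u v : V} (h : G.Valid u v) : G.Valid v u := by
  rcases h with h | h | ⟨rfl, h⟩
  · exact Or.inr (Or.inl h)
  · exact Or.inl h
  · exact Or.inr (Or.inr ⟨rfl, h⟩)

theorem PopularEdge.symm {u v : V} (h : G.PopularEdge u v) : G.PopularEdge v u := by
  obtain ⟨M, hM, h | ⟨rfl, h⟩⟩ := h
  · exact ⟨M, hM, Or.inl h.symm⟩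
  · exact ⟨M, hM, Or.inr ⟨rfl, h⟩⟩

theorem Legal.symm {u v : V} (h : G.Legal u v) : G.Legal v u :=
  ⟨h.1.symm, h.2.symm⟩

theorem Valid.isF_or_isS {a v : V} (h : G.Valid a v) (ha : a ∈ G.agents)
    (hv : G.graph.Adj a v ∨ v = a) : G.IsF a v ∨ G.IsS a v := by
  rcases h with h | ⟨hva, h⟩ | ⟨-, h, -⟩
  · exact h.2
  · rcases hv with hv | rfl
    · exact absurd hva ((G.agent_iff_of_adj hv).1 ha)
    · exact h
  · exact absurd ha h

theorem IsTopChoice.not_agent {b : V} (hb : G.IsTopChoice b) : b ∉ G.agents := by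
  obtain ⟨a, ha, h⟩ := hb
  exact (G.agent_iff_of_adj h.1).1 ha

/-- A top choice is never an `s(a)` and its self-loop is not valid, so only agents ranking it first
remain as partners. -/
theorem Valid.isF_of_isTopChoice {u b : V} (h : G.Valid u b) (hb : G.IsTopChoice b)
    (hu : G.graph.Adj b u ∨ u = b) : u ∈ G.agents ∧ G.IsF u b := by
  have hbA := hb.not_agent
  rcases hu with hu | rfl
  · have huA : u ∈ G.agents := by
      by_contra h'
      exact hbA ((G.agent_iff_of_adj hu).2 h')
    refine ⟨huA, (h.isF_or_isS huA (Or.inl hu.symm)).resolve_right ?_⟩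
    rintro (⟨-, h', -⟩ | ⟨rfl, -⟩)
    · exact h' hb
    · exact G.graph.irrefl hu
  · rcases h with h | h | h
    · exact absurd h.1 hbA
    · exact absurd h.1 hbA
    · exact absurd hb h.2.2

/-! ### Pairings encoding the final matching -/

variable (G) in
/-- The partner maps of a perfect legal stable matching in `H`: `p x` is the partner of `x_ℓ`, `q y`
is the partner of `y_r`, and `sp x`, `rp y` say that the edges at `x_ℓ`, `y_r` have the left
superscript plus. The set `C` consists of the marked vertices. -/
structure LegalPairing (C : Set V) (p q : V → V) (sp rp : V → Prop) : Prop where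
  adj_or_self : ∀ x, G.graph.Adj x (p x) ∨ p x = x
  q_p : ∀ x, q (p x) = x
  p_q : ∀ y, p (q y) = y
  sign : ∀ x, rp (p x) ↔ sp x
  loop : ∀ x, p x = x → ¬ sp x
  legal : ∀ x, G.Legal x (p x)
  stable_plus : ∀ x y, G.graph.Adj x y → (¬ sp x ∨ G.PrefersOrSelf x y (p x)) →
    rp y → ¬ G.PrefersOrSelf y x (q y)
  stable_minus : ∀ x y, G.graph.Adj x y → ¬ sp x → G.PrefersOrSelf x y (p x) →
    ¬ (rp y ∨ G.PrefersOrSelf y x (q y))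
  marked : ∀ x ∈ C, ¬ sp x ∧ ¬ rp x
  closed : ∀ x y, G.popularGraph.Adj x y → x ∈ C → y ∈ C
  candidate : ∀ x, p x ≠ x → ¬ sp x → ¬ rp x → x ∈ C

namespace LegalPairing

variable {C : Set V} {p q : V → V} {sp rp : V → Prop}

theorem p_eq_iff (h : G.LegalPairing C p q sp rp) {x y : V} : p x = y ↔ q y = x :=
  ⟨fun e => e ▸ h.q_p x, fun e => e ▸ h.p_q y⟩

theorem adj_or_self_q (h : G.LegalPairing C p q sp rp) (y : V) : G.graph.Adj y (q y) ∨ q y = y := by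
  have := h.adj_or_self (q y)
  rw [h.p_q] at this
  exact this.imp (fun e => e.symm) (fun e => e.symm)

theorem sign_q (h : G.LegalPairing C p q sp rp) (y : V) : rp y ↔ sp (q y) := by
  have := h.sign (q y)
  rwa [h.p_q] at this

theorem legal_q (h : G.LegalPairing C p q sp rp) (y : V) : G.Legal y (q y) := by
  have := h.legal (q y)
  rw [h.p_q] at this
  exact this.symm

/-- Legal edges are popular, so partners lie in the same component of the popular subgraph. -/
theorem mem_iff (h : G.LegalPairing C p q sp rp) (x : V) : p x ∈ C ↔ x ∈ C := by
  rcases h.adj_or_self x with hx | hx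
  · have hadj : G.popularGraph.Adj x (p x) := ⟨hx, (h.legal x).2⟩
    exact ⟨h.closed _ _ hadj.symm, h.closed _ _ hadj⟩
  · rw [hx]

theorem mem_iff_q (h : G.LegalPairing C p q sp rp) (y : V) : q y ∈ C ↔ y ∈ C := by
  have := h.mem_iff (q y)
  rw [h.p_q] at this
  exact this.symm

theorem isF_or_isS (h : G.LegalPairing C p q sp rp) {a : V} (ha : a ∈ G.agents) :
    G.IsF a (p a) ∨ G.IsS a (p a) :=
  (h.legal a).1.isF_or_isS ha (h.adj_or_self a)

theorem isF_or_isS_q (h : G.LegalPairing C p q sp rp) {a : V} (ha : a ∈ G.agents) :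
    G.IsF a (q a) ∨ G.IsS a (q a) :=
  (h.legal_q a).1.isF_or_isS ha (h.adj_or_self_q a)

theorem isF_p (h : G.LegalPairing C p q sp rp) {b : V} (hb : G.IsTopChoice b) :
    p b ∈ G.agents ∧ G.IsF (p b) b :=
  (h.legal b).1.symm.isF_of_isTopChoice hb (h.adj_or_self b)

theorem isF_q (h : G.LegalPairing C p q sp rp) {b : V} (hb : G.IsTopChoice b) :
    q b ∈ G.agents ∧ G.IsF (q b) b :=
  (h.legal_q b).1.symm.isF_of_isTopChoice hb (h.adj_or_self_q b)

/-- Both partners of `b` rank it first, and at marked vertices all edges have left superscript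
minus. If the partners differed, the edge from `b` to the better one would block in the half that
does not contain it. -/
theorem marked_eq_of_isTopChoice (h : G.LegalPairing C p q sp rp) {b : V} (hbC : b ∈ C)
    (hb : G.IsTopChoice b) :
    p b = q b := by
  by_contra hne
  obtain ⟨-, hFp⟩ := h.isF_p hb
  obtain ⟨-, hFq⟩ := h.isF_q hb
  rcases G.prefersOrSelf_total (h.adj_or_self b) (h.adj_or_self_q b) hne with hp | hp
  · refine h.stable_minus (p b) b hFp.1 (h.marked _ ((h.mem_iff b).2 hbC)).1 ?_ (Or.inr hp)
    exact hFp.prefersOrSelf G (h.adj_or_self _) fun e => hne ((h.p_eq_iff.1 e).symm)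
  · refine h.stable_minus b (q b) hFq.1.symm (h.marked _ hbC).1 hp (Or.inr ?_)
    exact hFq.prefersOrSelf G (h.adj_or_self_q _) fun e => hne (h.p_eq_iff.2 e)

/-- If one partner is a top choice, the previous lemma applies to it. Otherwise both partners are
`s(a)`, which is unique. -/
theorem marked_eq_of_agent (h : G.LegalPairing C p q sp rp) {a : V} (haC : a ∈ C)
    (ha : a ∈ G.agents) :
    p a = q a := by
  by_cases hp : G.IsTopChoice (p a)
  · have := h.marked_eq_of_isTopChoice ((h.mem_iff a).2 haC) hp
    rw [h.q_p] at this
    exact (h.p_eq_iff.1 this).symm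
  by_cases hq : G.IsTopChoice (q a)
  · have := h.marked_eq_of_isTopChoice ((h.mem_iff_q a).2 haC) hq
    rw [h.p_q] at this
    exact h.p_eq_iff.2 this.symm
  have hp' := (h.isF_or_isS ha).resolve_left fun hF => hp ⟨a, ha, hF⟩
  have hq' := (h.isF_or_isS_q ha).resolve_left fun hF => hq ⟨a, ha, hF⟩
  by_contra hne
  rcases G.prefersOrSelf_total (h.adj_or_self a) (h.adj_or_self_q a) hne with h' | h'
  · exact hq'.not_prefersOrSelf G hp h'
  · exact hp'.not_prefersOrSelf G hq h'

theorem marked_eq (h : G.LegalPairing C p q sp rp) {x : V} (hx : x ∈ C) : p x = q x := by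
  by_cases hA : x ∈ G.agents
  · exact h.marked_eq_of_agent hx hA
  rcases h.adj_or_self_q x with hq | hq
  · have hqA : q x ∈ G.agents := by
      by_contra h'
      exact hA ((G.agent_iff_of_adj hq).2 h')
    have := h.marked_eq_of_agent ((h.mem_iff_q x).2 hx) hqA
    rw [h.p_q] at this
    exact h.p_eq_iff.2 this.symm
  · rw [hq]
    exact h.p_eq_iff.2 hq

/-! ### Unmarked agents -/

/-- An unmarked agent with the same superscript in both halves cannot have its top choice in the
lower half only. -/
theorem not_isF_q (h : G.LegalPairing C p q sp rp) {a : V} (haC : a ∉ C) (hs : sp a ↔ ¬ rp a)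
    (hF : G.IsF a (q a))
    (ha : a ∈ G.agents) (hne : p a ≠ q a) : False := by
  obtain ⟨b, hb⟩ : ∃ b, b = q a := ⟨_, rfl⟩
  rw [← hb] at hF hne
  have hpb : p b = a := h.p_eq_iff.2 hb.symm
  have htop : G.IsTopChoice b := ⟨a, ha, hF⟩
  obtain ⟨hcA, hFc⟩ := h.isF_q htop
  have hbC : b ∉ C := fun hbC => haC (hpb ▸ (h.mem_iff b).2 hbC)
  have hcC : q b ∉ C := fun hcC => hbC ((h.mem_iff_q b).1 hcC)
  have hpbne : p b ≠ b := by rw [hpb]; exact hF.1.ne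
  have hsb : rp a ↔ sp b := by rw [← hpb]; exact h.sign b
  have hab : G.PrefersOrSelf a b (p a) := hF.prefersOrSelf G (h.adj_or_self a) hne
  have hca : q b ≠ a := fun e => hne (h.p_eq_iff.2 e)
  have hcb : G.PrefersOrSelf (q b) b (q (q b)) :=
    hFc.prefersOrSelf G (h.adj_or_self_q _) fun e => hca ((h.p_eq_iff.2 e).symm.trans hpb)
  -- With `b = f(a)` and `c = q b` its upper partner, upper stability makes `b` prefer `c` to `a`.
  -- As `b` is also the top choice of `c`, the lower copy of that edge blocks. The absence of
  -- unmarked candidates supplies the remaining superscript: at `b` in the first case, at `c` in the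
  -- second.
  by_cases hsa : sp a
  · have hnsb : ¬ sp b := fun h' => hs.1 hsa (hsb.2 h')
    have hrb : rp b := by
      by_contra hrb
      exact hbC (h.candidate b hpbne hnsb hrb)
    have hn := h.stable_plus a b hF.1 (Or.inr hab) hrb
    have hpref := (G.prefersOrSelf_total (Or.inl hF.1.symm) (h.adj_or_self_q b)
      hca.symm).resolve_left hn
    exact h.stable_minus b (q b) hFc.1.symm hnsb (hpb.symm ▸ hpref) (Or.inr hcb)
  · have hra : rp a := by
      by_contra hra
      exact hsa (hs.2 hra)
    have hn := not_or.1 (h.stable_minus a b hF.1 hsa hab)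
    have hpref := (G.prefersOrSelf_total (Or.inl hF.1.symm) (h.adj_or_self_q b)
      hca.symm).resolve_left hn.2
    have hnsc : ¬ sp (q b) := fun h' => hn.1 ((h.sign_q b).2 h')
    have hrc : rp (q b) := by
      by_contra hrc
      refine hcC (h.candidate _ ?_ hnsc hrc)
      rw [h.p_q]
      exact hFc.1.ne'
    exact h.stable_plus b (q b) hFc.1.symm (Or.inr (hpb.symm ▸ hpref)) hrc hcb

/-- Both partners are among `f(a)` and `s(a)`. A job strictly between them, with `q a` the better
one, forces `q a = f(a)`, which `not_isF_q` excludes. -/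
theorem not_between (h : G.LegalPairing C p q sp rp) {a b : V} (ha : a ∈ G.agents) (haC : a ∉ C)
    (hs : sp a ↔ ¬ rp a)
    (hq : G.PrefersOrSelf a (q a) b) : ¬ G.PrefersOrSelf a b (p a) := by
  intro hp
  have hqp := PrefersOrSelf.trans G hq hp
  have hne : p a ≠ q a := fun e => G.prefersOrSelf_irrefl a (p a) (by rw [← e] at hqp; exact hqp)
  rcases h.isF_or_isS_q ha with hF | hS
  · exact h.not_isF_q haC hs hF ha hne
  · rcases h.isF_or_isS ha with hF' | hS'
    · exact PrefersOrSelf.asymm G hqp (hF'.prefersOrSelf G (h.adj_or_self_q a) hne.symm)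
    · rcases hS with ⟨-, hn, -⟩ | ⟨e, -⟩
      · exact hS'.not_prefersOrSelf G hn hqp
      · exact G.graph.irrefl (e ▸ hq.1)

/-- Since `p b = q b`, the preference of `b` can be tested in the lower half. Whenever lower
stability makes `a` prefer `q a` to `b`, `not_between` prevents `a` from preferring `b` to `p a`.
These are the bounds needed for weight 0 at `b` and weight 1 or -1 at `a`. -/
theorem unmarked_marked (h : G.LegalPairing C p q sp rp) {a b : V} (ha : a ∈ G.agents)
    (hab : G.graph.Adj a b) (haC : a ∉ C)
    (hbC : b ∈ C) (hpa : p a ≠ a) :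
    ¬ (G.PrefersOrSelf a b (p a) ∧ G.PrefersOrSelf b a (q b)) ∧
      (¬ sp a → ¬ G.PrefersOrSelf a b (p a) ∧ ¬ G.PrefersOrSelf b a (q b)) := by
  have hpq := h.marked_eq hbC
  have hsb := (h.marked b hbC).1
  have hqa : b ≠ q a := fun e => haC ((h.mem_iff_q a).1 (e ▸ hbC))
  by_cases hra : rp a
  · have h1 : ¬ G.PrefersOrSelf b a (q b) := fun h' =>
      h.stable_minus b a hab.symm hsb (hpq ▸ h') (Or.inl hra)
    refine ⟨fun h' => h1 h'.2, fun hsa => ⟨?_, h1⟩⟩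
    have h2 := h.stable_plus b a hab.symm (Or.inl hsb) hra
    exact h.not_between ha haC (by tauto)
      ((G.prefersOrSelf_total (Or.inl hab) (h.adj_or_self_q a) hqa).resolve_left h2)
  · refine ⟨?_, fun hsa => absurd (h.candidate a hpa hsa hra) haC⟩
    rintro ⟨h1, h2⟩
    have h3 := not_or.1 (h.stable_minus b a hab.symm hsb (hpq ▸ h2))
    have hsa : sp a := by
      by_contra hsa
      exact haC (h.candidate a hpa hsa hra)
    exact h.not_between ha haC (by tauto)
      ((G.prefersOrSelf_total (Or.inl hab) (h.adj_or_self_q a) hqa).resolve_left h3.2) h1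

/-! ### The dual certificate -/

open scoped Classical in
/-- The dual certificate for the popularity of the upper half. -/
noncomputable def witness (G : MarriageInstance V) (C : Set V) (p : V → V) (sp rp : V → Prop)
    (u : V) : ℤ :=
  if p u = u ∨ u ∈ C then 0
  else if (u ∈ G.agents ∧ sp u) ∨ (u ∉ G.agents ∧ ¬ rp u) then 1 else -1

theorem witness_marked {u : V} (hu : u ∈ C) : witness G C p sp rp u = 0 :=
  if_pos (Or.inr hu)

open scoped Classical in
theorem witness_agent {a : V} (ha : a ∈ G.agents) (hp : p a ≠ a) (haC : a ∉ C) :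
    witness G C p sp rp a = if sp a then 1 else -1 := by
  simp [witness, ha, hp, haC]

open scoped Classical in
theorem witness_job {b : V} (hb : b ∉ G.agents) (hp : p b ≠ b) (hbC : b ∉ C) :
    witness G C p sp rp b = if rp b then -1 else 1 := by
  by_cases hr : rp b <;> simp [witness, hb, hp, hbC, hr]

end LegalPairing

open scoped Classical in
/-- The vote of `u` for `v` against `w`, where `u` itself stands for being unmatched. -/
noncomputable def vote (G : MarriageInstance V) (u v w : V) : ℤ :=
  (if G.PrefersOrSelf u v w then 1 else 0) - (if G.PrefersOrSelf u w v then 1 else 0)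

theorem vote_le_one (u v w : V) : G.vote u v w ≤ 1 := by
  unfold vote
  split_ifs <;> omega

theorem vote_eq_neg_one {u v w : V} (hv : G.graph.Adj u v ∨ v = u)
    (hw : G.graph.Adj u w ∨ w = u) (hvw : v ≠ w) (hn : ¬ G.PrefersOrSelf u v w) :
    G.vote u v w = -1 := by
  have := (G.prefersOrSelf_total hv hw hvw).resolve_left hn
  simp [vote, hn, this]

theorem vote_self (u v : V) : G.vote u v v = 0 := by
  simp [vote]

namespace LegalPairing

variable {C : Set V} {p q : V → V} {sp rp : V → Prop}

theorem vote_add_vote_nonpos (h : G.LegalPairing C p q sp rp) {a b : V} (hab : G.graph.Adj a b)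
    (hn : ¬ (G.PrefersOrSelf a b (p a) ∧ G.PrefersOrSelf b a (q b))) :
    G.vote a b (p a) + G.vote b a (q b) ≤ 0 := by
  by_cases e : p a = b
  · have e' := h.p_eq_iff.1 e
    rw [e, e', vote_self, vote_self]
    omega
  have e' : a ≠ q b := fun e' => e (h.p_eq_iff.2 e'.symm)
  have h1 := G.vote_le_one a b (p a)
  have h2 := G.vote_le_one b a (q b)
  by_cases hp : G.PrefersOrSelf a b (p a)
  · have := vote_eq_neg_one (Or.inl hab.symm) (h.adj_or_self_q b) e' fun h' => hn ⟨hp, h'⟩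
    omega
  · have := vote_eq_neg_one (Or.inl hab) (h.adj_or_self a) (Ne.symm e) hp
    omega

theorem vote_add_vote_eq (h : G.LegalPairing C p q sp rp) {a b : V} (hab : G.graph.Adj a b)
    (hne : p a ≠ b)
    (h1 : ¬ G.PrefersOrSelf a b (p a)) (h2 : ¬ G.PrefersOrSelf b a (q b)) :
    G.vote a b (p a) + G.vote b a (q b) = -2 := by
  have e' : a ≠ q b := fun e' => hne (h.p_eq_iff.2 e'.symm)
  rw [vote_eq_neg_one (Or.inl hab.symm) (h.adj_or_self_q b) e' h2,
    vote_eq_neg_one (Or.inl hab) (h.adj_or_self a) (Ne.symm hne) h1]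
  omega

theorem vote_add_vote_le_witness (h : G.LegalPairing C p q sp rp) {a b : V} (ha : a ∈ G.agents)
    (hab : G.graph.Adj a b) :
    G.vote a b (p a) + G.vote b a (q b) ≤ witness G C p sp rp a + witness G C p sp rp b := by
  have hb : b ∉ G.agents := (G.agent_iff_of_adj hab).1 ha
  -- An edge preferred by both ends blocks in the upper half unless both ends have superscript plus
  -- there.
  have hnb : ¬ (sp a ∧ ¬ rp b) →
      ¬ (G.PrefersOrSelf a b (p a) ∧ G.PrefersOrSelf b a (q b)) := by
    rintro hn ⟨h1, h2⟩
    by_cases hr : rp b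
    · exact h.stable_plus a b hab (Or.inr h1) hr h2
    · exact h.stable_minus a b hab (fun hs => hn ⟨hs, hr⟩) h1 (Or.inr h2)
  -- If `a` is unmatched, then `s(a) = a`, so `b` is a top choice and hence matched. The upper edge
  -- with superscript minus at `a` does not block, which gives `b` superscript plus and a
  -- nonnegative weight.
  by_cases hpa : p a = a
  · have htop : G.IsTopChoice b := by
      rcases h.isF_or_isS ha with hF | ⟨hadj, -⟩ | ⟨-, hS⟩
      · exact absurd (hpa ▸ hF.1) G.graph.irrefl
      · exact absurd (hpa ▸ hadj) G.graph.irrefl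
      · exact hS b hab
    have hpref : G.PrefersOrSelf a b (p a) := ⟨hab, Or.inl hpa⟩
    have hsa := h.loop a hpa
    have hn := not_or.1 (h.stable_minus a b hab hsa hpref)
    have hle := h.vote_add_vote_nonpos hab fun h' => hn.2 h'.2
    have hwa : witness G C p sp rp a = 0 := if_pos (Or.inl hpa)
    have hwb : 0 ≤ witness G C p sp rp b := by
      unfold witness
      split_ifs <;> first | omega | tauto
    omega
  -- If `b` is unmatched, it is nobody's top choice, so `a` does not prefer it. Lower stability
  -- gives `a` superscript plus in the lower half; as unmarked candidates are excluded, the weight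
  -- of `a` cannot be -1.
  by_cases hpb : p b = b
  · have hntop : ¬ G.IsTopChoice b := fun htop => hb (hpb ▸ (h.isF_p htop).1)
    have hn1 : ¬ G.PrefersOrSelf a b (p a) := by
      intro hp
      rcases h.isF_or_isS ha with hF | hS
      · exact PrefersOrSelf.asymm G hp (hF.prefersOrSelf G (Or.inl hab)
          fun e => hntop ⟨a, ha, e ▸ hF⟩)
      · exact hS.not_prefersOrSelf G hntop hp
    have hle := h.vote_add_vote_nonpos hab fun h' => hn1 h'.1
    have hra := not_or.1 (h.stable_minus b a hab.symm (h.loop b hpb) ⟨hab.symm, Or.inl hpb⟩)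
    have hwb : witness G C p sp rp b = 0 := if_pos (Or.inl hpb)
    have hwa : 0 ≤ witness G C p sp rp a := by
      have := h.candidate a hpa
      unfold witness
      split_ifs <;> first | omega | tauto
    omega
  have hle1 := G.vote_le_one a b (p a)
  have hle2 := G.vote_le_one b a (q b)
  -- Superscript minus at both ends: the edge is not in M, whose edges carry opposite superscripts,
  -- and stability against both upper copies makes both votes -1.
  have hminus : ¬ sp a → rp b → G.vote a b (p a) + G.vote b a (q b) = -2 := by
    intro hsa hrb
    refine h.vote_add_vote_eq hab (fun e => hsa ((h.sign a).1 (e ▸ hrb))) ?_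
      (h.stable_plus a b hab (Or.inl hsa) hrb)
    exact fun hp => h.stable_minus a b hab hsa hp (Or.inl hrb)
  have hle := fun hn => h.vote_add_vote_nonpos hab (hnb hn)
  have hwa := fun haC => witness_agent (C := C) (sp := sp) (rp := rp) ha hpa haC
  have hwb := fun hbC => witness_job (C := C) (sp := sp) (rp := rp) hb hpb hbC
  by_cases haC : a ∈ C <;> by_cases hbC : b ∈ C
  · have := hle fun h' => (h.marked a haC).1 h'.1
    rwa [witness_marked haC, witness_marked hbC]
  · have hsa := (h.marked a haC).1
    rw [witness_marked haC, hwb hbC]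
    by_cases hrb : rp b
    · have := hminus hsa hrb
      rw [if_pos hrb]
      omega
    · have := hle fun h' => hsa h'.1
      rw [if_neg hrb]
      omega
  · obtain ⟨h1, h2⟩ := h.unmarked_marked ha hab haC hbC hpa
    rw [hwa haC, witness_marked hbC]
    by_cases hsa : sp a
    · have := h.vote_add_vote_nonpos hab h1
      rw [if_pos hsa]
      omega
    · have := h.vote_add_vote_eq hab (fun e => haC ((h.mem_iff a).1 (e ▸ hbC))) (h2 hsa).1
        (h2 hsa).2
      rw [if_neg hsa]
      omega
  · rw [hwa haC, hwb hbC]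
    by_cases hsa : sp a <;> by_cases hrb : rp b
    · have := hle fun h' => h'.2 hrb
      simpa [hsa, hrb] using this
    · simp only [hsa, hrb, if_true, if_false]
      omega
    · have := hminus hsa hrb
      simp only [hsa, hrb, if_true, if_false]
      omega
    · have := hle fun h' => hsa h'.1
      simpa [hsa, hrb] using this

end LegalPairing
/-! ### Matchings and partner maps -/

/-- `m` maps every vertex to its partner in `M`, and every vertex without a partner to itself. -/
def IsPartnerMap (M : G.graph.Subgraph) (m : V → V) : Prop :=
  ∀ u v, M.Adj u v ↔ v = m u ∧ v ≠ u

theorem exists_isPartnerMap {M : G.graph.Subgraph} (hM : M.IsMatching) :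
    ∃ m, IsPartnerMap M m := by
  have hex : ∀ u, ∃ w, ∀ v, M.Adj u v ↔ v = w ∧ v ≠ u := by
    intro u
    by_cases hu : u ∈ M.verts
    · obtain ⟨w, hw, hu⟩ := hM hu
      refine ⟨w, fun v => ⟨fun hv => ⟨hu v hv, (M.adj_sub hv).ne'⟩, ?_⟩⟩
      rintro ⟨rfl, -⟩
      exact hw
    · refine ⟨u, fun v => ⟨fun hv => absurd (M.edge_vert hv) hu, fun hv => absurd hv.1 hv.2⟩⟩
  choose m hm using hex
  exact ⟨m, hm⟩

namespace IsPartnerMap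

variable {M N : G.graph.Subgraph} {m n : V → V}

theorem adj (hm : IsPartnerMap M m) {u : V} (hu : m u ≠ u) : G.graph.Adj u (m u) :=
  M.adj_sub ((hm u (m u)).2 ⟨rfl, hu⟩)

theorem adj_or_self (hm : IsPartnerMap M m) (u : V) : G.graph.Adj u (m u) ∨ m u = u :=
  or_iff_not_imp_right.2 hm.adj

theorem involutive (hm : IsPartnerMap M m) : Function.Involutive m := by
  intro u
  by_cases hu : m u = u
  · rw [hu, hu]
  · exact (((hm _ _).1 ((hm u (m u)).2 ⟨rfl, hu⟩).symm).1).symm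

theorem votesFor_iff (hm : IsPartnerMap M m) (hn : IsPartnerMap N n) (u : V) :
    G.VotesFor M N u ↔ G.PrefersOrSelf u (m u) (n u) := by
  constructor
  · rintro ⟨v, hv, hN⟩
    obtain ⟨rfl, hne⟩ := (hm u v).1 hv
    refine ⟨hm.adj hne, ?_⟩
    by_cases hu : n u = u
    · exact Or.inl hu
    · exact Or.inr ⟨hn.adj hu, hN _ ((hn u _).2 ⟨rfl, hu⟩)⟩
  · rintro ⟨hadj, h⟩
    refine ⟨m u, (hm u _).2 ⟨rfl, hadj.ne'⟩, fun w hw => ?_⟩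
    obtain ⟨rfl, hne⟩ := (hn u w).1 hw
    exact (h.resolve_left hne).2

open scoped Classical in
theorem phi_eq_sum [Fintype V] (hm : IsPartnerMap M m) (hn : IsPartnerMap N n) :
    (G.phi M N : ℤ) = ∑ u, if G.PrefersOrSelf u (m u) (n u) then 1 else 0 := by
  unfold phi
  simp only [hm.votesFor_iff hn]
  rw [Set.ncard_eq_toFinset_card', Set.toFinset_ofPred, Finset.card_filter]
  push_cast
  rfl

theorem phi_sub_phi [Fintype V] (hm : IsPartnerMap M m) (hn : IsPartnerMap N n) :
    (G.phi N M : ℤ) - G.phi M N = ∑ u, G.vote u (n u) (m u) := by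
  rw [hn.phi_eq_sum hm, hm.phi_eq_sum hn, ← Finset.sum_sub_distrib]
  rfl

/-- Weak duality: a matching with a dual certificate of value zero is popular. -/
theorem phi_le_of_witness [Finite V] (hm : IsPartnerMap M m) (hn : IsPartnerMap N n) (α : V → ℤ)
    (hedge : ∀ u v, G.graph.Adj u v → G.vote u v (m u) + G.vote v u (m v) ≤ α u + α v)
    (hself : ∀ u, G.vote u u (m u) ≤ α u) (hzero : ∀ u, α u + α (m u) = 0) :
    G.phi N M ≤ G.phi M N := by
  have := Fintype.ofFinite V
  have hsum : ∀ (k : V → V), Function.Involutive k → ∀ f : V → ℤ, ∑ u, f (k u) = ∑ u, f u :=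
    fun k hk f => Equiv.sum_comp hk.toPerm f
  have h1 : ∑ u, (α u + α (m u)) = 0 := Finset.sum_eq_zero fun u _ => hzero u
  rw [Finset.sum_add_distrib, hsum m hm.involutive] at h1
  -- Summing over the pairs `u`, `n u` counts each edge and each self-loop of N twice, so `hedge`
  -- and `hself` apply termwise; involutivity of `n` then turns both sides into doubled vertex sums.
  have h2 : ∑ u, (G.vote u (n u) (m u) + G.vote (n u) (n (n u)) (m (n u))) ≤
      ∑ u, (α u + α (n u)) := by
    refine Finset.sum_le_sum fun u _ => ?_
    rw [hn.involutive u]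
    rcases hn.adj_or_self u with hu | hu
    · exact hedge u (n u) hu
    · rw [hu]
      have := hself u
      omega
  rw [Finset.sum_add_distrib, Finset.sum_add_distrib, hsum n hn.involutive,
    hsum n hn.involutive fun u => G.vote u (n u) (m u)] at h2
  have := hm.phi_sub_phi hn
  omega

end IsPartnerMap

/-! ### The upper half of a legal stable matching -/

open scoped Classical in
/-- The partners in the upper half. -/
noncomputable def upperPartner (G : MarriageInstance V) (p q : V → V) (u : V) : V :=
  if u ∈ G.agents then p u else q u

namespace LegalPairing

variable {C : Set V} {p q : V → V} {sp rp : V → Prop}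

theorem self_iff (h : G.LegalPairing C p q sp rp) (u : V) :
    G.upperPartner p q u = u ↔ p u = u := by
  unfold upperPartner
  split_ifs
  · rfl
  · exact h.p_eq_iff.symm

theorem upperPartner_adj_or_self (h : G.LegalPairing C p q sp rp) (u : V) :
    G.graph.Adj u (G.upperPartner p q u) ∨ G.upperPartner p q u = u := by
  unfold upperPartner
  split_ifs
  · exact h.adj_or_self u
  · exact h.adj_or_self_q u

theorem vote_self_le_witness (h : G.LegalPairing C p q sp rp) (u : V) :
    G.vote u u (G.upperPartner p q u) ≤ witness G C p sp rp u := by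
  by_cases hu : p u = u
  · rw [(h.self_iff u).2 hu, vote_self, witness, if_pos (Or.inl hu)]
  · have hne := fun e => hu ((h.self_iff u).1 e)
    rw [vote_eq_neg_one (Or.inr rfl) (h.upperPartner_adj_or_self u) (Ne.symm hne)
      fun hp => G.graph.irrefl hp.1]
    unfold witness
    split_ifs <;> omega

/-- The ends of an edge of `H` carry opposite superscripts, and partners are marked together, so the
weights cancel. -/
theorem witness_add_witness_p (h : G.LegalPairing C p q sp rp) {a : V} (ha : a ∈ G.agents) :
    witness G C p sp rp a + witness G C p sp rp (p a) = 0 := by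
  by_cases hC : a ∈ C
  · rw [witness_marked hC, witness_marked ((h.mem_iff a).2 hC), add_zero]
  rcases h.adj_or_self a with hadj | hp
  · have hpp : p (p a) ≠ p a := fun e => hadj.ne ((h.q_p a).symm.trans (h.p_eq_iff.1 e))
    rw [witness_agent ha hadj.ne' hC, witness_job ((G.agent_iff_of_adj hadj).1 ha) hpp
      fun hC' => hC ((h.mem_iff a).1 hC')]
    by_cases hs : sp a
    · rw [if_pos hs, if_pos ((h.sign a).2 hs)]
      omega
    · rw [if_neg hs, if_neg fun hr => hs ((h.sign a).1 hr)]
      omega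
  · rw [hp, witness, if_pos (Or.inl hp), add_zero]

theorem witness_add_witness (h : G.LegalPairing C p q sp rp) (u : V) :
    witness G C p sp rp u + witness G C p sp rp (G.upperPartner p q u) = 0 := by
  unfold upperPartner
  split_ifs with hu
  · exact h.witness_add_witness_p hu
  rcases h.adj_or_self_q u with hadj | hq
  · have ha : q u ∈ G.agents := by
      by_contra h'
      exact hu ((G.agent_iff_of_adj hadj).2 h')
    have := h.witness_add_witness_p ha
    rw [h.p_q] at this
    omega
  · rw [hq, witness, if_pos (Or.inl (h.p_eq_iff.2 hq)), add_zero]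

theorem popular [Finite V] (h : G.LegalPairing C p q sp rp) {M : G.graph.Subgraph}
    (hM : M.IsMatching) (hm : IsPartnerMap M (G.upperPartner p q)) : G.Popular M := by
  refine ⟨hM, fun N hN => ?_⟩
  obtain ⟨n, hn⟩ := exists_isPartnerMap hN
  have hedge : ∀ u v, u ∈ G.agents → G.graph.Adj u v →
      G.vote u v (G.upperPartner p q u) + G.vote v u (G.upperPartner p q v) ≤
        witness G C p sp rp u + witness G C p sp rp v := by
    intro u v hu huv
    rw [upperPartner, upperPartner, if_pos hu, if_neg ((G.agent_iff_of_adj huv).1 hu)]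
    exact h.vote_add_vote_le_witness hu huv
  refine hm.phi_le_of_witness hn (witness G C p sp rp) ?_ h.vote_self_le_witness
    h.witness_add_witness
  intro u v huv
  by_cases hu : u ∈ G.agents
  · exact hedge u v hu huv
  · have hv : v ∈ G.agents := by
      by_contra h'
      exact hu ((G.agent_iff_of_adj huv).2 h')
    have := hedge v u hv huv.symm
    omega

theorem isTopChoice_of_prefersOrSelf (h : G.LegalPairing C p q sp rp) {a b : V}
    (ha : a ∈ G.agents) (hp : G.PrefersOrSelf a b (p a)) : G.IsTopChoice b := by
  by_contra hb
  rcases h.isF_or_isS ha with hF | hS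
  · by_cases hne : b = p a
    · exact G.prefersOrSelf_irrefl a b (by rwa [← hne] at hp)
    · exact PrefersOrSelf.asymm G hp (hF.prefersOrSelf G (Or.inl hp.1) hne)
  · exact hS.not_prefersOrSelf G hb hp

theorem aPopular [Finite V] (h : G.LegalPairing C p q sp rp) {M : G.graph.Subgraph}
    (hM : M.IsMatching) (hm : IsPartnerMap M (G.upperPartner p q)) : G.APopular M := by
  refine ⟨hM, fun N hN => ?_⟩
  obtain ⟨n, hn⟩ := exists_isPartnerMap hN
  have hq : Function.Injective q := fun x y e => by
    rw [← h.p_q x, e, h.p_q]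
  unfold phiA
  -- Each agent voting for N is sent to the agent holding its N-partner in M. That agent ranks this
  -- job first and does not have it in N.
  refine Set.ncard_le_ncard_of_injOn (fun a => q (n a)) ?_
    (fun x _ y _ e => hn.involutive.injective (hq e)) (Set.toFinite _)
  rintro a ⟨ha, hv⟩
  rw [hn.votesFor_iff hm, upperPartner, if_pos ha] at hv
  have htop := h.isTopChoice_of_prefersOrSelf ha hv
  obtain ⟨hcA, hF⟩ := h.isF_q htop
  refine ⟨hcA, ?_⟩
  rw [hm.votesFor_iff hn, upperPartner, if_pos hcA, h.p_q]
  refine hF.prefersOrSelf G (hn.adj_or_self _) fun e => ?_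
  have e' : q (n a) = a := hn.involutive.injective e
  rw [← h.p_eq_iff.2 e'] at hv
  exact G.prefersOrSelf_irrefl _ _ hv

end LegalPairing

/-! ### From the matching in `H` to a pairing -/

theorem exists_legalPairing {S : Set (HEdge V)} {C : Set V} (hS : G.IsStableH S)
    (hF : ∀ e ∈ S, e ∉ G.forbidden C) (hall : AllMatched S)
    (hclosed : ∀ u v, G.popularGraph.Adj u v → u ∈ C → v ∈ C)
    (hcand : ∀ v ∈ G.candidates S, v ∈ C) :
    ∃ p q sp rp, G.LegalPairing C p q sp rp ∧
      ∀ a ∈ G.agents, ∀ b, b ∉ G.agents → (G.InUpperHalf S a b ↔ p a = b) := by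
  obtain ⟨⟨hH, huniq⟩, hblock⟩ := hS
  obtain ⟨hl, hr⟩ := hall
  choose l hlS hll using hl
  choose r hrS hrr using hr
  have hlu : ∀ e ∈ S, ∀ x, e.left = x → e = l x := fun e he x hx =>
    huniq e he _ (hlS x) (Or.inl (hx.trans (hll x).symm))
  have hru : ∀ e ∈ S, ∀ y, e.right = y → e = r y := fun e he y hy =>
    huniq e he _ (hrS y) (Or.inr (hy.trans (hrr y).symm))
  have hrl : ∀ x, r (l x).right = l x := fun x => (hru _ (hlS x) _ rfl).symm
  have hlr : ∀ y, l (r y).left = r y := fun y => (hlu _ (hrS y) _ rfl).symm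
  have hminus : ∀ σ : Superscript, σ ≠ .plus → σ = .minus := by
    intro σ h
    cases σ
    · exact absurd rfl h
    · rfl
  have hlegal : ∀ e ∈ S, G.Legal e.left e.right := by
    intro e he
    by_contra hn
    exact hF e he ⟨hH e he, Or.inl hn⟩
  have hmark : ∀ e ∈ S, e.leftSign = .plus → e.left ∉ G.agents ∩ C ∧ e.right ∉ G.agents ∩ C := by
    intro e he hs
    have := hF e he
    simp only [forbidden, Set.mem_ofPred_eq, not_and, not_or] at this
    exact (this (hH e he)).2 hs
  have hplus : ∀ e ∈ S, e.leftSign = .plus → G.graph.Adj e.left e.right := by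
    intro e he hs
    refine (hH e he).resolve_right fun h => ?_
    rw [hs] at h
    exact Superscript.noConfusion h.2
  -- Plus edges are forbidden only at agents of `C`. An edge of `S` is popular, so its ends are in
  -- `C` together, and one of them is an agent; this extends the exclusion to jobs of `C`.
  have hmarked : ∀ e ∈ S, e.leftSign = .plus → e.left ∉ C ∧ e.right ∉ C := by
    intro e he hs
    have hadj := hplus e he hs
    have hpop : G.popularGraph.Adj e.left e.right := ⟨hadj, (hlegal e he).2⟩
    have h1 := hmark e he hs
    have h2 := G.agent_iff_of_adj hadj
    have h3 := hclosed _ _ hpop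
    have h4 := hclosed _ _ hpop.symm
    simp only [Set.mem_inter_iff] at h1
    tauto
  refine ⟨fun x => (l x).right, fun y => (r y).left, fun x => (l x).leftSign = .plus,
    fun y => (r y).leftSign = .plus, ⟨?_, ?_, ?_, ?_, ?_, ?_, ?_, ?_, ?_, hclosed, ?_⟩, ?_⟩
  · intro x
    have := hH _ (hlS x)
    rw [IsHEdge, hll] at this
    exact this.imp id fun h => h.1.symm
  · intro x
    rw [hrl, hll]
  · intro y
    rw [hlr, hrr]
  · intro x
    rw [hrl]
  · intro x hx hs
    have := hplus _ (hlS x) hs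
    rw [hll, hx] at this
    exact G.graph.irrefl this
  · intro x
    have := hlegal _ (hlS x)
    rwa [hll] at this
  · intro x y hxy hx hy hyx
    refine hblock ⟨x, y, .plus⟩ ⟨Or.inl hxy, ?_, ?_⟩
    · intro e he hex
      have hel := hlu e he x hex
      refine ⟨hex.symm, ?_⟩
      by_cases hs : e.leftSign = .plus
      · refine Or.inr ⟨hs.symm, ?_⟩
        rw [hel] at hs ⊢
        exact hx.resolve_left fun h => h hs
      · exact Or.inl ⟨rfl, hminus _ hs⟩
    · intro e he hey
      have her := hru e he y hey
      refine ⟨hey.symm, Or.inr ⟨?_, ?_⟩⟩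
      · rw [her, hy]
      · rw [her]
        exact hyx
  · intro x y hxy hs hx hy
    refine hblock ⟨x, y, .minus⟩ ⟨Or.inl hxy, ?_, ?_⟩
    · intro e he hex
      have hel := hlu e he x hex
      refine ⟨hex.symm, Or.inr ⟨?_, ?_⟩⟩
      · rw [hel, hminus _ hs]
      · rw [hel]
        exact hx
    · intro e he hey
      have her := hru e he y hey
      refine ⟨hey.symm, ?_⟩
      by_cases hs' : e.leftSign = .plus
      · exact Or.inl ⟨rfl, hs'⟩
      · refine Or.inr ⟨(hminus _ hs').symm, ?_⟩
        rw [her] at hs' ⊢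
        exact hy.resolve_left hs'
  · intro x hx
    refine ⟨fun hs => (hmarked _ (hlS x) hs).1 ?_, fun hs => (hmarked _ (hrS x) hs).2 ?_⟩
    · rwa [hll]
    · rwa [hrr]
  · intro x hx hs hs'
    have hadj : G.graph.Adj x (l x).right := by
      have := hH _ (hlS x)
      rw [IsHEdge, hll] at this
      exact this.resolve_right fun h => hx h.1.symm
    have hadj' : G.graph.Adj x (r x).left := by
      have := hH _ (hrS x)
      rw [IsHEdge, hrr] at this
      refine (this.resolve_right fun h => hx ?_).symm
      -- A self-loop held at the right copy of `x` is also the edge at its left copy, contradicting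
      -- `hx`.
      rw [← hlu _ (hrS x) x h.1, hrr]
    have h1 : (⟨x, (l x).right, .minus⟩ : HEdge V) ∈ S := by
      have : (⟨x, (l x).right, .minus⟩ : HEdge V) = l x :=
        HEdge.ext (hll x).symm rfl (hminus _ hs).symm
      rw [this]
      exact hlS x
    have h2 : (⟨(r x).left, x, .minus⟩ : HEdge V) ∈ S := by
      have : (⟨(r x).left, x, .minus⟩ : HEdge V) = r x :=
        HEdge.ext rfl (hrr x).symm (hminus _ hs').symm
      rw [this]
      exact hrS x
    have hA := G.agent_iff_of_adj hadj
    have hA' := G.agent_iff_of_adj hadj'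
    refine hcand x ?_
    by_cases hxA : x ∈ G.agents
    · exact Or.inl ⟨⟨hxA, _, hA.1 hxA, h1⟩, ⟨hxA, _, hA'.1 hxA, h2⟩⟩
    · exact Or.inr ⟨⟨hxA, _, by tauto, h2⟩, ⟨hxA, _, by tauto, h1⟩⟩
  · intro a ha b hb
    constructor
    · rintro ⟨-, -, h | h⟩
      · exact congrArg HEdge.right (hlu _ h a rfl).symm
      · exact congrArg HEdge.right (hlu _ h a rfl).symm
    · intro hab
      refine ⟨ha, hb, ?_⟩
      have hmem : (⟨a, b, (l a).leftSign⟩ : HEdge V) ∈ S := by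
        have : (⟨a, b, (l a).leftSign⟩ : HEdge V) = l a := HEdge.ext (hll a).symm hab.symm rfl
        rw [this]
        exact hlS a
      by_cases hs : (l a).leftSign = .plus
      · rw [hs] at hmem
        exact Or.inl hmem
      · rw [hminus _ hs] at hmem
        exact Or.inr hmem

theorem LegalPairing.isPartnerMap_upperHalf {C : Set V} {p q : V → V} {sp rp : V → Prop}
    (h : G.LegalPairing C p q sp rp) {S : Set (HEdge V)}
    (hS : ∀ a ∈ G.agents, ∀ b, b ∉ G.agents → (G.InUpperHalf S a b ↔ p a = b)) :
    IsPartnerMap (G.upperHalf S) (G.upperPartner p q) := by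
  intro u v
  change G.graph.Adj u v ∧ (G.InUpperHalf S u v ∨ G.InUpperHalf S v u) ↔ _
  constructor
  · rintro ⟨huv, hc | hc⟩
    · rw [upperPartner, if_pos hc.1]
      exact ⟨((hS u hc.1 v hc.2.1).1 hc).symm, huv.ne'⟩
    · rw [upperPartner, if_neg hc.2.1]
      exact ⟨(h.p_eq_iff.1 ((hS v hc.1 u hc.2.1).1 hc)).symm, huv.ne'⟩
  · rintro ⟨rfl, hne⟩
    have hadj := (h.upperPartner_adj_or_self u).resolve_right hne
    have hA := G.agent_iff_of_adj hadj
    refine ⟨hadj, ?_⟩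
    by_cases hu : u ∈ G.agents
    · refine Or.inl ((hS u hu _ (hA.1 hu)).2 ?_)
      rw [upperPartner, if_pos hu]
    · refine Or.inr ((hS _ (by tauto) u hu).2 ?_)
      rw [upperPartner, if_neg hu, h.p_q]

theorem isMatching_upperHalf {S : Set (HEdge V)} {m : V → V}
    (hm : IsPartnerMap (G.upperHalf S) m) : (G.upperHalf S).IsMatching := by
  rintro u ⟨v, hv⟩
  have hv' : (G.upperHalf S).Adj u v := hv
  exact ⟨v, hv', fun w hw => ((hm u w).1 hw).1.trans ((hm u v).1 hv').1.symm⟩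

end MarriageInstance

theorem mainTheorem2 {V : Type*} [Finite V] (G : MarriageInstance V)
    (hG : ∀ a ∈ G.agents, ∃ b, G.graph.Adj a b)
    (S : Set (HEdge V)) (hS : G.FinalMatching S) :
    (G.IsStableH S ∧ G.IsLegalH S) ∧
      G.Popular (G.upperHalf S) ∧ G.APopular (G.upperHalf S) ∧
      G.FullyPopular (G.upperHalf S) := by
  obtain ⟨t, ht, rfl, hcand⟩ := hS
  obtain ⟨hinv, hF, hall, hclosed⟩ := ht.invariant
  have hstable := hinv.isStableH hall
  obtain ⟨p, q, sp, rp, h, hp⟩ :=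
    MarriageInstance.exists_legalPairing hstable hF hall hclosed hcand
  have hm := h.isPartnerMap_upperHalf hp
  have hM := MarriageInstance.isMatching_upperHalf hm
  refine ⟨⟨hstable, fun e he => ?_⟩, h.popular hM hm, h.aPopular hM hm, h.popular hM hm,
    h.aPopular hM hm⟩
  by_contra hn
  exact hF e he ⟨hstable.1.1 e he, Or.inl hn⟩
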